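/- Let $\Bbbk$ be $\mathbb{R}$ or $\mathbb{C}$, and let $\mathbf{G}\le \mathrm{GL}_n(\Bbbk)$ be a simple algebraic group over $\Bbbk$ (identified with its group of $\Bbbk$-points), that is: $\mathbf{G}$ is Zariski closed, Zariski connected and non-commutative, and every Zariski closed normal subgroup of $\mathbf{G}$ is finite or equal to $\mathbf{G}$. Let $G$ be $\mathbf{G}$ itself or, more generally, any subgroup of $\mathbf{G}$ that is open in the Euclidean topology (for example the identity component of $\mathbf{G}$). Let $K\le G$ be a subgroup that is Zariski dense in $\mathbf{G}$, not assumed to be discrete. For $g\in G$ write $K^g=g^{-1}Kg$, let $$\operatorname{Comm}_G(K)=\{g\in G : K\cap K^g \text{ has finite index in both } K \text{ and } K^g\}$$ be the commensurator of $K$ in $G$, and let $$K^G=\langle\, K^g \mid g\in \operatorname{Comm}_G(K)\,\rangle$$ be the subgroup of $G$ generated by the conjugates of $K$ by elements of $\operatorname{Comm}_G(K)$. If $K^G$ is a discrete subgroup of $G$ (in the Euclidean topology), then $\operatorname{Comm}_G(K)$ is a discrete subgroup of $G$. -/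

import Mathlib

open scoped MatrixGroups

/-- The Zariski topology on `GL_n(𝕜)`: its basic open sets are the non-vanishing loci of polynomials
in the matrix entries. (Regular functions on `GL_n` are polynomials in the entries divided by powers
of the determinant, so that nothing is gained by allowing denominators.) -/
@[reducible] def zariskiTopology (𝕜 : Type*) [Field 𝕜] (n : ℕ) : TopologicalSpace (GL (Fin n) 𝕜) :=
  TopologicalSpace.generateFrom
    {U | ∃ p : MvPolynomial (Fin n × Fin n) 𝕜,
      U = {g : GL (Fin n) 𝕜 | MvPolynomial.eval (fun ij => g ij.1 ij.2) p ≠ 0}}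

/-- The group `A` of `𝕜`-points of a simple linear algebraic group over `𝕜`, embedded in `GL_n(𝕜)`:
it is Zariski closed and Zariski connected, it is not commutative, and its proper Zariski closed
normal subgroups are finite. Simplicity is the usual one of algebraic groups (sometimes called
almost simplicity): a finite centre is allowed. -/
structure IsSimpleAlgebraicGroup {𝕜 : Type*} [Field 𝕜] {n : ℕ} (A : Subgroup (GL (Fin n) 𝕜)) :
    Prop where
  isClosed : @IsClosed _ (zariskiTopology 𝕜 n) (A : Set (GL (Fin n) 𝕜))
  isConnected : @IsConnected _ (zariskiTopology 𝕜 n) (A : Set (GL (Fin n) 𝕜))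
  not_comm : ∃ x ∈ A, ∃ y ∈ A, x * y ≠ y * x
  finite_or_eq : ∀ N : Subgroup (GL (Fin n) 𝕜), N ≤ A →
    @IsClosed _ (zariskiTopology 𝕜 n) (N : Set (GL (Fin n) 𝕜)) → (N.subgroupOf A).Normal →
    (N : Set (GL (Fin n) 𝕜)).Finite ∨ N = A

/-- The subset `S` of `A ⊆ GL_n(𝕜)` is Zariski dense in `A`. -/
def IsZariskiDenseIn {𝕜 : Type*} [Field 𝕜] {n : ℕ} (S A : Set (GL (Fin n) 𝕜)) : Prop :=
  S ⊆ A ∧ A ⊆ @closure _ (zariskiTopology 𝕜 n) S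

/-- The subgroup of `G` generated by the conjugates `K ^ g = g⁻¹ K g`, where `g` runs through the
commensurator of `K` in `G`. -/
def commensuratorConjugates {G : Type*} [Group G] (K : Subgroup G) : Subgroup G :=
  Subgroup.closure {x | ∃ g ∈ Subgroup.Commensurable.commensurator K, ∃ k ∈ K, x = g⁻¹ * k * g}

/-! The commensurator `Γ` normalizes the discrete group `K^G`. For `h` in `K^G` the map `g ↦ g h
g⁻¹` on `Γ` is continuous with discrete target, so it is constant near `1`
(`eventually_commute_of_discrete`). The neighbourhood depends on `h`, but finitely many elements of
`K` have the same centralizer as `K` (`exists_finite_subset_commute`). Hence elements of `Γ` near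
`1` centralize `K`, and by Zariski density all of `A`; the centre of `A` is finite by simplicity. -/

/-- Zero loci of polynomials in the matrix entries are Zariski closed. -/
theorem isClosed_zariski_zeroLocus {𝕜 : Type*} [Field 𝕜] {n : ℕ}
    (p : MvPolynomial (Fin n × Fin n) 𝕜) :
    @IsClosed _ (zariskiTopology 𝕜 n)
      {g : GL (Fin n) 𝕜 | MvPolynomial.eval (fun ij => g ij.1 ij.2) p = 0} := by
  let _ := zariskiTopology 𝕜 n
  rw [← isOpen_compl_iff]
  exact TopologicalSpace.isOpen_generateFrom_of_mem ⟨p, rfl⟩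

/-- Centralizers of elements are Zariski closed. -/
theorem isClosed_zariski_commute {𝕜 : Type*} [Field 𝕜] {n : ℕ} (x : GL (Fin n) 𝕜) :
    @IsClosed _ (zariskiTopology 𝕜 n) {y : GL (Fin n) 𝕜 | x * y = y * x} := by
  let _ := zariskiTopology 𝕜 n
  have h : {y : GL (Fin n) 𝕜 | x * y = y * x} =
      ⋂ i : Fin n, ⋂ j : Fin n, {g : GL (Fin n) 𝕜 | MvPolynomial.eval (fun ij => g ij.1 ij.2)
        (∑ k, (MvPolynomial.C (x i k) * MvPolynomial.X (k, j)
          - MvPolynomial.X (i, k) * MvPolynomial.C (x k j))) = 0} := by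
    ext y
    simp only [Set.mem_ofPred_eq, Set.mem_iInter, map_sum, map_sub, map_mul,
      MvPolynomial.eval_C, MvPolynomial.eval_X, Finset.sum_sub_distrib, sub_eq_zero]
    rw [Units.ext_iff, ← Matrix.ext_iff]
    simp only [Units.val_mul, Matrix.mul_apply]
  rw [h]
  exact isClosed_iInter fun i => isClosed_iInter fun j => isClosed_zariski_zeroLocus _

/-- An element commuting with a Zariski dense subset of `A` commutes with `A`. -/
theorem IsZariskiDenseIn.commute {𝕜 : Type*} [Field 𝕜] {n : ℕ} {S A : Set (GL (Fin n) 𝕜)}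
    (h : IsZariskiDenseIn S A) {x : GL (Fin n) 𝕜} (hx : ∀ s ∈ S, x * s = s * x) :
    ∀ a ∈ A, x * a = a * x := by
  let _ := zariskiTopology 𝕜 n
  intro a ha
  exact closure_minimal (t := {y | x * y = y * x}) hx (isClosed_zariski_commute x) (h.2 ha)

/-- A simple algebraic group has finite centre. -/
theorem IsSimpleAlgebraicGroup.finite_center {𝕜 : Type*} [Field 𝕜] {n : ℕ}
    {A : Subgroup (GL (Fin n) 𝕜)} (hA : IsSimpleAlgebraicGroup A) :
    {x : GL (Fin n) 𝕜 | x ∈ A ∧ ∀ a ∈ A, x * a = a * x}.Finite := by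
  let _ := zariskiTopology 𝕜 n
  let Z : Subgroup (GL (Fin n) 𝕜) := A ⊓ Subgroup.centralizer A
  have hZ : {x : GL (Fin n) 𝕜 | x ∈ A ∧ ∀ a ∈ A, x * a = a * x} = Z := by
    ext x
    simp only [Set.mem_ofPred_eq, Z, SetLike.mem_coe, Subgroup.mem_inf,
      Subgroup.mem_centralizer_iff, eq_comm]
  have hclosed : IsClosed (Z : Set (GL (Fin n) 𝕜)) := by
    have : (Z : Set (GL (Fin n) 𝕜)) = (A : Set (GL (Fin n) 𝕜)) ∩ ⋂ a ∈ A, {x | a * x = x * a} := by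
      ext x
      simp [Z, Subgroup.mem_centralizer_iff]
    rw [this]
    exact hA.isClosed.inter (isClosed_biInter fun a _ => isClosed_zariski_commute a)
  have hnormal : (Z.subgroupOf A).Normal := by
    refine ⟨fun z hz g => ?_⟩
    have hzg : (g : GL (Fin n) 𝕜) * z = z * g :=
      Subgroup.mem_centralizer_iff.1 (Subgroup.mem_subgroupOf.1 hz).2 g g.2
    have : g * z * g⁻¹ = z := by
      rw [mul_inv_eq_iff_eq_mul]
      exact Subtype.ext hzg
    rwa [this]
  rw [hZ]
  refine (hA.finite_or_eq Z inf_le_left hclosed hnormal).resolve_right fun h => ?_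
  obtain ⟨x, hx, y, hy, hxy⟩ := hA.not_comm
  have hy' : y ∈ Z := h ▸ hy
  exact hxy (Subgroup.mem_centralizer_iff.1 hy'.2 x hx)

/-- Commuting with a set of invertible matrices is equivalent to commuting with a suitable finite
subset of it. -/
theorem exists_finite_subset_commute {𝕜 : Type*} [Field 𝕜] {n : ℕ} (S : Set (GL (Fin n) 𝕜)) :
    ∃ T ⊆ S, T.Finite ∧
      ∀ x : GL (Fin n) 𝕜, (∀ t ∈ T, x * t = t * x) → ∀ s ∈ S, x * s = s * x := by
  -- Commuting with `x` is a linear condition, so a finite subset with the same linear span in the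
  -- matrix space suffices.
  let f : GL (Fin n) 𝕜 → Matrix (Fin n) (Fin n) 𝕜 := fun g => g
  obtain ⟨t, htS, ht⟩ := (Submodule.fg_span_iff_fg_span_finset_subset (f '' S)).1
    (IsNoetherian.noetherian (Submodule.span 𝕜 (f '' S)))
  obtain ⟨T, hTS, hT, hTt⟩ := Set.exists_subset_image_finite_and (p := fun u => Submodule.span 𝕜 (f '' S) = Submodule.span 𝕜 u).1
    ⟨_, htS, t.finite_toSet, ht⟩
  refine ⟨T, hTS, hT, fun x hx s hs => Units.ext ?_⟩
  have hs' : f s ∈ Submodule.span 𝕜 (f '' T) := hTt ▸ Submodule.subset_span ⟨s, hs, rfl⟩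
  change f x * f s = f s * f x
  generalize f s = m at hs' ⊢
  induction hs' using Submodule.span_induction with
  | mem _ h =>
    obtain ⟨t, ht, rfl⟩ := h
    exact congrArg Units.val (hx t ht)
  | zero => simp
  | add a b _ _ ha hb => rw [mul_add, add_mul, ha, hb]
  | smul c a _ ha => rw [mul_smul_comm, smul_mul_assoc, ha]

theorem le_commensuratorConjugates {G : Type*} [Group G] (K : Subgroup G) :
    K ≤ commensuratorConjugates K := fun k hk =>
  Subgroup.subset_closure ⟨1, one_mem _, k, hk, by simp⟩

/-- The commensurator normalizes the group generated by the conjugates. -/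
theorem conj_mem_commensuratorConjugates {G : Type*} [Group G] {K : Subgroup G} {g h : G}
    (hg : g ∈ Subgroup.Commensurable.commensurator K) (hh : h ∈ commensuratorConjugates K) :
    g * h * g⁻¹ ∈ commensuratorConjugates K := by
  have hle : commensuratorConjugates K ≤
      (commensuratorConjugates K).comap (MulAut.conj g).toMonoidHom := by
    refine (Subgroup.closure_le _).2 ?_
    rintro _ ⟨c, hc, k, hk, rfl⟩
    -- With conjugates written `c⁻¹ k c`, conjugating by `g` replaces `c` by `c * g⁻¹`.
    refine Subgroup.subset_closure ⟨c * g⁻¹, mul_mem hc (inv_mem hg), k, hk, ?_⟩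
    simp [mul_assoc]
  simpa using hle hh

/-- An element of a discrete subgroup `H` is centralized by all elements close to `1` of any
subgroup normalizing `H`. -/
theorem eventually_commute_of_discrete {G : Type*} [Group G] [TopologicalSpace G]
    [IsTopologicalGroup G] {H Γ : Subgroup G} [DiscreteTopology H]
    (hconj : ∀ g ∈ Γ, ∀ h ∈ H, g * h * g⁻¹ ∈ H) {h : G} (hh : h ∈ H) :
    ∀ᶠ g : Γ in nhds 1, (g : G) * h = h * g := by
  let φ : Γ → H := fun g => ⟨g * h * (g : G)⁻¹, hconj g g.2 h hh⟩
  have hφ : Continuous φ := by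
    refine Continuous.subtype_mk ?_ _
    fun_prop
  have hφ1 : φ 1 = ⟨h, hh⟩ := Subtype.ext (by simp [φ])
  have hopen : φ ⁻¹' {⟨h, hh⟩} ∈ nhds (1 : Γ) :=
    ((isOpen_discrete _).preimage hφ).mem_nhds hφ1
  filter_upwards [hopen] with g hg
  exact mul_inv_eq_iff_eq_mul.1 (congrArg Subtype.val hg)

theorem mainTheorem6 {𝕜 : Type*} [RCLike 𝕜] {n : ℕ}
    (A : Subgroup (GL (Fin n) 𝕜)) (hA : IsSimpleAlgebraicGroup A)
    (G : Subgroup (GL (Fin n) 𝕜)) (hG : G ≤ A) (hGopen : IsOpen (G.subgroupOf A : Set A))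
    (K : Subgroup G)
    (hK : IsZariskiDenseIn (K.map G.subtype : Set (GL (Fin n) 𝕜)) (A : Set (GL (Fin n) 𝕜)))
    (hdisc : DiscreteTopology (commensuratorConjugates K)) :
    DiscreteTopology (Subgroup.Commensurable.commensurator K) := by
  obtain ⟨T, hTK, hT, hcomm⟩ := exists_finite_subset_commute (K.map G.subtype : Set (GL (Fin n) 𝕜))
  have hev : ∀ᶠ g : Subgroup.Commensurable.commensurator K in nhds 1,
      ∀ t ∈ T, ((g : G) : GL (Fin n) 𝕜) * t = t * (g : G) := by
    refine (Filter.eventually_all_finite hT).2 fun t ht => ?_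
    obtain ⟨k, hk, rfl⟩ := hTK ht
    filter_upwards [eventually_commute_of_discrete (Γ := Subgroup.Commensurable.commensurator K)
      (fun g hg h hh => conj_mem_commensuratorConjugates hg hh)
      (le_commensuratorConjugates K hk)] with g hg
    exact congrArg Subtype.val hg
  have hinj : Function.Injective
      fun g : Subgroup.Commensurable.commensurator K => ((g : G) : GL (Fin n) 𝕜) :=
    Subtype.val_injective.comp Subtype.val_injective
  -- Elements of the commensurator that are central in `A` form a finite neighbourhood of `1`; in a
  -- Hausdorff group this isolates `1`.
  have hfin := hA.finite_center.preimage hinj.injOn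
  refine discreteTopology_of_isOpen_singleton_one
    (isOpen_singleton_of_finite_mem_nhds 1 (Filter.mem_of_superset hev fun g hg => ?_) hfin)
  exact ⟨hG (g : G).2, hK.commute (hcomm _ hg)⟩
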